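/- Let $T$ be a complete first-order theory, and let formulas be formulas of its language without parameters. For $n\in\omega$, an $n$-formula of $T$ is a formula $\varphi(\overline x)$ that is $T$-equivalent to a Boolean combination of formulas each of which has at most $n$ free variables. The theory $T$ is $n$-ary, for $n\neq 1$, if every formula is an $n$-formula of $T$; it is $1$-ary (unary) if every formula is $T$-equivalent to a Boolean combination of formulas with at most one free variable and of formulas $x\approx y$. The theory $T$ is almost $n$-ary if there are finitely many formulas $\varphi_1(\overline x),\ldots,\varphi_s(\overline x)$ such that every formula is $T$-equivalent to a Boolean combination of $n$-formulas of $T$ and of formulas obtained from $\varphi_1,\ldots,\varphi_s$ by substituting variables for the free variables. Let $\mathrm{ar}(T)$ be the least $n\in\omega$ such that $T$ is $n$-ary, and $\mathrm{aar}(T)$ the least $n\in\omega$ such that $T$ is almost $n$-ary (the value is $\infty$ if there is no such $n$). Theorem. For all positive integers $m\leq n$ there is a complete first-order theory $T_{mn}$ with $\mathrm{aar}(T_{mn})=m$ and $\mathrm{ar}(T_{mn})=n$. -/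

import Mathlib

namespace ArityOfTheories

open FirstOrder FirstOrder.Language

universe u v w

variable {L : FirstOrder.Language.{u, v}}

/-- `IsBoolComb Δ φ`: the formula `φ` is a (finite) Boolean combination of formulas in `Δ`. -/
inductive IsBoolComb {α : Type w} (Δ : Set (L.Formula α)) : L.Formula α → Prop
  | of {φ : L.Formula α} (h : φ ∈ Δ) : IsBoolComb Δ φ
  | bot : IsBoolComb Δ ⊥
  | not {φ : L.Formula α} (h : IsBoolComb Δ φ) : IsBoolComb Δ φ.not
  | inf {φ ψ : L.Formula α} (h₁ : IsBoolComb Δ φ) (h₂ : IsBoolComb Δ ψ) : IsBoolComb Δ (φ ⊓ ψ)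
  | sup {φ ψ : L.Formula α} (h₁ : IsBoolComb Δ φ) (h₂ : IsBoolComb Δ ψ) : IsBoolComb Δ (φ ⊔ ψ)

/-- `φ` is `T`-equivalent to a Boolean combination of formulas in `Δ`. -/
def IsBasedOn {α : Type w} (T : L.Theory) (Δ : Set (L.Formula α)) (φ : L.Formula α) : Prop :=
  ∃ ψ : L.Formula α, IsBoolComb Δ ψ ∧ (φ ⇔[T] ψ)

/-- The formulas in the variables `x₀, …, x_{k-1}` with at most `n` free variables. (With dummy
variables such as in `x = x` any of them can be regarded as a formula of `n` free variables.) -/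
def formulasOfArity (L : FirstOrder.Language.{u, v}) (n k : ℕ) : Set (L.Formula (Fin k)) :=
  {φ | φ.freeVarFinset.card ≤ n}

/-- The formulas `xᵢ = xⱼ` in the variables `x₀, …, x_{k-1}`. -/
def equalities (L : FirstOrder.Language.{u, v}) (k : ℕ) : Set (L.Formula (Fin k)) :=
  {φ | ∃ i j : Fin k, φ = (Term.var i).equal (Term.var j)}

/-- `φ` is an `n`-formula of `T`: it is `T`-equivalent to a Boolean combination of formulas with
`n` free variables. For `n = 0` this means that `φ` is `T`-equivalent to a sentence. -/
def IsNFormula (T : L.Theory) (n : ℕ) {k : ℕ} (φ : L.Formula (Fin k)) : Prop :=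
  IsBasedOn T (formulasOfArity L n k) φ

/-- `T` is unary: every formula is `T`-equivalent to a Boolean combination of formulas with one
free variable and of equalities between variables. -/
def IsUnary (T : L.Theory) : Prop :=
  ∀ (k : ℕ) (φ : L.Formula (Fin k)), IsBasedOn T (formulasOfArity L 1 k ∪ equalities L k) φ

/-- `T` is `n`-ary. For `n = 1` this means unary (so that equalities are admitted); for every other
`n` it means that every formula is an `n`-formula of `T`. -/
def IsNAry (T : L.Theory) (n : ℕ) : Prop :=
  if n = 1 then IsUnary T else ∀ (k : ℕ) (φ : L.Formula (Fin k)), IsNFormula T n φ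

/-- The formulas in the variables `x₀, …, x_{k-1}` obtained from the formulas in `Φ` by
substituting variables for the free variables (distinct variables may be identified). -/
def substitutions {r : ℕ} (Φ : Set (L.Formula (Fin r))) (k : ℕ) : Set (L.Formula (Fin k)) :=
  {χ | ∃ φ ∈ Φ, ∃ f : Fin r → Fin k, χ = φ.relabel f}

/-- `T` is almost `n`-ary: for some finite set `Φ` of formulas, in a common tuple of variables,
every formula is `T`-equivalent to a Boolean combination of `n`-formulas and of formulas obtained
from those in `Φ` by substitution of variables. -/
def IsAlmostNAry (T : L.Theory) (n : ℕ) : Prop :=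
  ∃ (r : ℕ) (Φ : Set (L.Formula (Fin r))), Φ.Finite ∧
    ∀ (k : ℕ) (φ : L.Formula (Fin k)),
      IsBasedOn T ({ψ : L.Formula (Fin k) | IsNFormula T n ψ} ∪ substitutions Φ k) φ

/-- The arity of `T`: the least `n` such that `T` is `n`-ary, and `∞` if there is none. -/
noncomputable def ar (T : L.Theory) : ℕ∞ :=
  sInf {N : ℕ∞ | ∃ n : ℕ, IsNAry T n ∧ N = n}

/-- The almost arity of `T`: the least `n` such that `T` is almost `n`-ary, and `∞` if there is
none. -/
noncomputable def aar (T : L.Theory) : ℕ∞ :=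
  sInf {N : ℕ∞ | ∃ n : ℕ, IsAlmostNAry T n ∧ N = n}

end ArityOfTheories

namespace ArityOfTheories

open FirstOrder FirstOrder.Language

/-! ### Boolean combinations modulo the theory of a structure -/

section General

universe u v w

variable {L : FirstOrder.Language.{u, v}} {M : Type w} [L.Structure M]

/-! Take two-point columns `(i, j)` and, for each `i`, a `d i`-ary relation telling whether a
transversal of the columns `(i, j)`, `j < d i`, has even parity. Flipping two of these columns
preserves everything, so formulas with fewer than `d i` free variables cannot detect a single flip,
although parity does (`not_isBasedOn_parFormula`). Every formula reduces to atomic ones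
(`isBasedOn_atomic`), since tuples with the same finite diagram are conjugate. Hence the arity is
the largest `d i`. Finitely many extra formulas can absorb finitely many parity relations but see
only finitely many indices, so the almost arity depends only on the values `d i` taken infinitely
often. With `d 0 = n` and all other `d i = m` the two values are `n` and `m`. -/

theorem iff_completeTheory_of_forall_realize_iff {k : ℕ} {φ ψ : L.Formula (Fin k)}
    (h : ∀ v : Fin k → M, φ.Realize v ↔ ψ.Realize v) : φ ⇔[L.completeTheory M] ψ := by
  have key : ∀ (N : Type (max u v)) [L.Structure N],
      N ⊨ (((φ.iff ψ).relabel (Sum.inr : Fin k → Empty ⊕ Fin k)).iAlls (Fin k) : L.Sentence) ↔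
        ∀ v : Fin k → N, φ.Realize v ↔ ψ.Realize v := by
    intro N _
    simp [Sentence.Realize, Formula.realize_iAlls, Function.comp_def]
  -- `key` does not cover `M`, which lives in another universe.
  have keyM :
      M ⊨ (((φ.iff ψ).relabel (Sum.inr : Fin k → Empty ⊕ Fin k)).iAlls (Fin k) : L.Sentence) := by
    simpa [Sentence.Realize, Formula.realize_iAlls, Function.comp_def] using h
  refine Theory.models_formula_iff.2 fun N v => ?_
  have := (key N).1 ((realize_iff_of_model_completeTheory M N _).2 keyM) v
  exact Formula.realize_iff.2 this

/-- A formula based on a set of formulas that do not separate two tuples does not separate them. -/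
theorem IsBasedOn.realize_iff [Nonempty M] {k : ℕ} {Δ : Set (L.Formula (Fin k))} {φ : L.Formula (Fin k)}
    (h : IsBasedOn (L.completeTheory M) Δ φ) {a b : Fin k → M}
    (hab : ∀ δ ∈ Δ, δ.Realize a ↔ δ.Realize b) : φ.Realize a ↔ φ.Realize b := by
  obtain ⟨ψ, hψ, hφ⟩ := h
  have hr : ∀ v : Fin k → M, φ.Realize v ↔ ψ.Realize v := fun v => hφ.realize_iff
  rw [hr, hr]
  clear hφ hr
  induction hψ with
  | of h => exact hab _ h
  | bot => exact Iff.rfl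
  | not _ ih => exact not_congr ih
  | inf _ _ ih₁ ih₂ => simp only [Formula.realize_inf, ih₁, ih₂]
  | sup _ _ ih₁ ih₂ => simp only [Formula.realize_sup, ih₁, ih₂]

theorem IsBasedOn.trans [Nonempty M] {k : ℕ} {Δ Γ : Set (L.Formula (Fin k))} {φ : L.Formula (Fin k)}
    (h : IsBasedOn (L.completeTheory M) Δ φ)
    (hΔ : ∀ δ ∈ Δ, IsBasedOn (L.completeTheory M) Γ δ) :
    IsBasedOn (L.completeTheory M) Γ φ := by
  obtain ⟨ψ, hψ, hφ⟩ := h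
  suffices IsBasedOn (L.completeTheory M) Γ ψ by
    obtain ⟨χ, hχ, hψχ⟩ := this
    exact ⟨χ, hχ, hφ.trans hψχ⟩
  clear hφ
  induction hψ with
  | of h => exact hΔ _ h
  | bot => exact ⟨⊥, .bot, Theory.Iff.refl _⟩
  | not _ ih =>
    obtain ⟨χ, hχ, h⟩ := ih
    exact ⟨χ.not, .not hχ, h.not⟩
  | inf _ _ ih₁ ih₂ =>
    obtain ⟨χ₁, hχ₁, h₁⟩ := ih₁
    obtain ⟨χ₂, hχ₂, h₂⟩ := ih₂
    exact ⟨χ₁ ⊓ χ₂, .inf hχ₁ hχ₂, iff_completeTheory_of_forall_realize_iff fun v => by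
      simp only [Formula.realize_inf, h₁.realize_iff, h₂.realize_iff]⟩
  | sup _ _ ih₁ ih₂ =>
    obtain ⟨χ₁, hχ₁, h₁⟩ := ih₁
    obtain ⟨χ₂, hχ₂, h₂⟩ := ih₂
    exact ⟨χ₁ ⊔ χ₂, .sup hχ₁ hχ₂, iff_completeTheory_of_forall_realize_iff fun v => by
      simp only [Formula.realize_sup, h₁.realize_iff, h₂.realize_iff]⟩

theorem IsBasedOn.of_forall_realize_iff {k : ℕ} {Δ : Set (L.Formula (Fin k))}
    {φ δ : L.Formula (Fin k)} (hδ : δ ∈ Δ) (h : ∀ v : Fin k → M, φ.Realize v ↔ δ.Realize v) :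
    IsBasedOn (L.completeTheory M) Δ φ :=
  ⟨δ, .of hδ, iff_completeTheory_of_forall_realize_iff h⟩

theorem IsBasedOn.of_mem {k : ℕ} {Δ : Set (L.Formula (Fin k))} {φ : L.Formula (Fin k)}
    (h : φ ∈ Δ) : IsBasedOn (L.completeTheory M) Δ φ :=
  .of_forall_realize_iff h fun _ => Iff.rfl

/-- A set of tuples that is invariant under agreement on finitely many formulas is defined by a
Boolean combination of these formulas. -/
theorem exists_isBoolComb_of_finite {k : ℕ} {F : Set (L.Formula (Fin k))} (hF : F.Finite) :
    ∀ X : Set (Fin k → M),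
      (∀ v w, (∀ δ ∈ F, δ.Realize v ↔ δ.Realize w) → v ∈ X → w ∈ X) →
      ∃ ψ : L.Formula (Fin k), IsBoolComb F ψ ∧ ∀ v, ψ.Realize v ↔ v ∈ X := by
  have mono : ∀ {F G : Set (L.Formula (Fin k))} {ψ : L.Formula (Fin k)}, F ⊆ G →
      IsBoolComb F ψ → IsBoolComb G ψ := by
    intro F G ψ hFG h
    induction h with
    | of h => exact .of (hFG h)
    | bot => exact .bot
    | not _ ih => exact .not ih
    | inf _ _ ih₁ ih₂ => exact .inf ih₁ ih₂
    | sup _ _ ih₁ ih₂ => exact .sup ih₁ ih₂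
  induction F, hF using Set.Finite.induction_on with
  | empty =>
    intro X hX
    by_cases h : X.Nonempty
    · obtain ⟨v₀, hv₀⟩ := h
      exact ⟨(⊥ : L.Formula (Fin k)).not, .not .bot, fun v => by
        simpa using hX v₀ v (by simp) hv₀⟩
    · refine ⟨⊥, .bot, fun v => ?_⟩
      rw [Set.not_nonempty_iff_eq_empty.1 h]
      simp
  | @insert δ F _ _ ih =>
    intro X hX
    -- Split `X` by the truth of `δ` and saturate each half under agreement on `F`.
    obtain ⟨ψ₁, hψ₁, h₁⟩ := ih {v | ∃ w ∈ X, δ.Realize w ∧ ∀ ε ∈ F, ε.Realize w ↔ ε.Realize v} (by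
      rintro v w hvw ⟨u, hu, hδ, huv⟩
      exact ⟨u, hu, hδ, fun ε hε => (huv ε hε).trans (hvw ε hε)⟩)
    obtain ⟨ψ₀, hψ₀, h₀⟩ := ih {v | ∃ w ∈ X, ¬ δ.Realize w ∧ ∀ ε ∈ F, ε.Realize w ↔ ε.Realize v} (by
      rintro v w hvw ⟨u, hu, hδ, huv⟩
      exact ⟨u, hu, hδ, fun ε hε => (huv ε hε).trans (hvw ε hε)⟩)
    have hsub := Set.subset_insert δ F
    refine ⟨(δ ⊓ ψ₁) ⊔ (δ.not ⊓ ψ₀),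
      .sup (.inf (.of (Set.mem_insert _ _)) (mono hsub hψ₁))
        (.inf (.not (.of (Set.mem_insert _ _))) (mono hsub hψ₀)), fun v => ?_⟩
    simp only [Formula.realize_sup, Formula.realize_inf, Formula.realize_not, h₁, h₀,
      Set.mem_ofPred_eq]
    constructor
    · rintro (⟨hv, w, hw, hδ, hwv⟩ | ⟨hv, w, hw, hδ, hwv⟩)
      · refine hX w v ?_ hw
        rintro ε (rfl | hε)
        exacts [iff_of_true hδ hv, hwv ε hε]
      · refine hX w v ?_ hw
        rintro ε (rfl | hε)
        exacts [iff_of_false hδ hv, hwv ε hε]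
    · intro hv
      by_cases hδ : δ.Realize v
      · exact .inl ⟨hδ, v, hv, hδ, fun _ _ => Iff.rfl⟩
      · exact .inr ⟨hδ, v, hv, hδ, fun _ _ => Iff.rfl⟩

theorem IsBasedOn.of_finite {k : ℕ} {F : Set (L.Formula (Fin k))} (hF : F.Finite)
    {φ : L.Formula (Fin k)}
    (h : ∀ v w : Fin k → M, (∀ δ ∈ F, δ.Realize v ↔ δ.Realize w) → φ.Realize v → φ.Realize w) :
    IsBasedOn (L.completeTheory M) F φ := by
  obtain ⟨ψ, hψ, hr⟩ := exists_isBoolComb_of_finite hF {v : Fin k → M | φ.Realize v} h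
  exact ⟨ψ, hψ, iff_completeTheory_of_forall_realize_iff fun v => (hr v).symm⟩

theorem realize_iff_of_eqOn_freeVarFinset {k : ℕ} (φ : L.Formula (Fin k)) {v w : Fin k → M}
    (h : ∀ i ∈ φ.freeVarFinset, v i = w i) : φ.Realize v ↔ φ.Realize w := by
  have hv := BoundedFormula.realize_restrictFreeVar (φ := φ) (xs := (default : Fin 0 → M)) (f := id)
    (v := fun i => v i) v (fun _ => rfl)
  have hw := BoundedFormula.realize_restrictFreeVar (φ := φ) (xs := (default : Fin 0 → M)) (f := id)
    (v := fun i => v i) w (fun i => h i i.2)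
  exact hv.symm.trans hw

theorem card_freeVarFinset_rel_le {k l : ℕ} (R : L.Relations l) (g : Fin l → Fin k) :
    (R.formula fun i => Term.var (g i) : L.Formula (Fin k)).freeVarFinset.card ≤ l := by
  have : (R.formula fun i => Term.var (g i) : L.Formula (Fin k)).freeVarFinset
      ⊆ Finset.univ.image g := by
    intro x
    simp [Relations.formula, Relations.boundedFormula, BoundedFormula.freeVarFinset,
      Term.varFinsetLeft, eq_comm]
  exact (Finset.card_le_card this).trans (Finset.card_image_le.trans (by simp))

theorem card_freeVarFinset_equal_le {k : ℕ} (i j : Fin k) :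
    ((Term.var i).equal (Term.var j) : L.Formula (Fin k)).freeVarFinset.card ≤ 2 := by
  have : ((Term.var i).equal (Term.var j) : L.Formula (Fin k)).freeVarFinset = {i, j} := by
    ext x
    simp [Term.equal, Term.bdEqual, BoundedFormula.freeVarFinset, Term.varFinsetLeft]
  rw [this]
  exact Finset.card_le_two

end General

/-- Two finite tuples with the same equality pattern that agree on `p` are conjugate under a
permutation fixing `p` pointwise. -/
theorem exists_perm_extending {X ι : Type*} [Finite ι] (p : X → Prop) {v w : ι → X}
    (he : ∀ a b, v a = v b ↔ w a = w b) (hp : ∀ a, p (v a) → v a = w a)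
    (hp' : ∀ a, p (w a) → p (v a)) :
    ∃ σ : Equiv.Perm X, (∀ x, p x → σ x = x) ∧ ∀ a, σ (v a) = w a := by
  classical
  have := Fintype.ofFinite ι
  suffices ∀ s : Finset ι, ∃ σ : Equiv.Perm X, (∀ x, p x → σ x = x) ∧ ∀ a ∈ s, σ (v a) = w a by
    obtain ⟨σ, h, h'⟩ := this Finset.univ
    exact ⟨σ, h, fun a => h' a (Finset.mem_univ a)⟩
  intro s
  induction s using Finset.induction_on with
  | empty => exact ⟨1, by simp, by simp⟩
  | insert c s _ ih =>
    obtain ⟨σ, hσ, hs⟩ := ih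
    by_cases hc : σ (v c) = w c
    · refine ⟨σ, hσ, fun a ha => ?_⟩
      rcases Finset.mem_insert.1 ha with rfl | ha
      exacts [hc, hs a ha]
    have hvc : ¬ p (v c) := fun h => hc (by rw [hσ _ h, hp _ h])
    -- The swap corrects the value at `v c`; the two points it moves lie outside `p` and differ from
    -- all values already fixed.
    refine ⟨Equiv.swap (σ (v c)) (w c) * σ, fun x hx => ?_, fun a ha => ?_⟩
    · rw [Equiv.Perm.mul_apply, hσ x hx]
      refine Equiv.swap_apply_of_ne_of_ne ?_ ?_
      · intro h
        have : σ x = σ (v c) := by rw [hσ x hx, h]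
        exact hvc (σ.injective this ▸ hx)
      · rintro rfl
        exact hvc (hp' c hx)
    · rcases Finset.mem_insert.1 ha with rfl | ha
      · simp
      · rw [Equiv.Perm.mul_apply, hs a ha]
        have hne : v a ≠ v c := by
          intro h
          exact hc (by rw [← h, hs a ha]; exact (he a c).1 h)
        refine Equiv.swap_apply_of_ne_of_ne ?_ fun h => hne ((he a c).2 h)
        rw [← hs a ha]
        exact fun h => hne (σ.injective h)

/-! ### The structure of columns and parity relations -/

section Parity

/-- The relation symbols: unary predicates for the columns `(i, j)` with `j < d i`, and for each
`i` a parity relation of arity `d i`. -/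
inductive ParityRel (d : ℕ → ℕ) : ℕ → Type
  | col (i : ℕ) (j : Fin (d i)) : ParityRel d 1
  | par (i : ℕ) : ParityRel d (d i)

/-- The language of the columns and the parity relations. -/
def parityLang (d : ℕ → ℕ) : FirstOrder.Language.{0, 0} where
  Functions _ := Empty
  Relations := ParityRel d

/-- The carrier: the element `(i, j, e)` is the one of the two points of the column `(i, j)`
that has parity `e`. -/
abbrev Pt : Type := ℕ × ℕ × ZMod 2

/-- The point `x` lies in the column `(i, j)`. -/
def InCol (i j : ℕ) (x : Pt) : Prop := x.1 = i ∧ x.2.1 = j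

/-- The tuple `x` runs through the columns `(i, 0), …, (i, d - 1)` and has even parity. -/
def EvenTuple (i : ℕ) {d : ℕ} (x : Fin d → Pt) : Prop :=
  (∀ j : Fin d, InCol i j (x j)) ∧ ∑ j, (x j).2.2 = 0

variable {d : ℕ → ℕ}

instance parityStructure : (parityLang d).Structure Pt where
  funMap := fun f => f.elim
  RelMap := fun {_} R => match R with
    | .col i j => fun x => InCol i j (x 0)
    | .par i => fun x => EvenTuple i x

variable (d) in
/-- The theory of the structure of columns and parity relations. -/
abbrev parityTheory : (parityLang d).Theory := (parityLang d).completeTheory Pt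

/-- The formula saying that `x_a` lies in the column `(i, j)`. -/
def colFormula {k : ℕ} (i : ℕ) (j : Fin (d i)) (a : Fin k) : (parityLang d).Formula (Fin k) :=
  Relations.formula (L := parityLang d) (ParityRel.col i j) fun _ => Term.var a

/-- The formula saying that the tuple `x_g` is even. -/
def parFormula {k : ℕ} (i : ℕ) (g : Fin (d i) → Fin k) : (parityLang d).Formula (Fin k) :=
  Relations.formula (L := parityLang d) (ParityRel.par i) fun l => Term.var (g l)

theorem realize_colFormula {k : ℕ} {i : ℕ} {j : Fin (d i)} {a : Fin k} {v : Fin k → Pt} :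
    (colFormula i j a).Realize v ↔ InCol i j (v a) :=
  Formula.realize_rel

theorem realize_parFormula {k : ℕ} {i : ℕ} {g : Fin (d i) → Fin k} {v : Fin k → Pt} :
    (parFormula i g).Realize v ↔ EvenTuple i (v ∘ g) :=
  Formula.realize_rel

theorem card_freeVarFinset_colFormula_le {k : ℕ} (i : ℕ) (j : Fin (d i)) (a : Fin k) :
    (colFormula i j a).freeVarFinset.card ≤ 1 :=
  card_freeVarFinset_rel_le _ _

theorem card_freeVarFinset_parFormula_le {k : ℕ} (i : ℕ) (g : Fin (d i) → Fin k) :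
    (parFormula i g).freeVarFinset.card ≤ d i :=
  card_freeVarFinset_rel_le _ _

/-! ### Permutations preserving a finite part of the structure -/

variable (d) in
/-- The permutation `σ` preserves the columns and the parity relation of index `i`. -/
def PreservesAt (i : ℕ) (σ : Equiv.Perm Pt) : Prop :=
  (∀ j : Fin (d i), ∀ x, InCol i j (σ x) ↔ InCol i j x) ∧
    ∀ x : Fin (d i) → Pt, EvenTuple i (σ ∘ x) ↔ EvenTuple i x

theorem PreservesAt.mul {i : ℕ} {σ τ : Equiv.Perm Pt} (hσ : PreservesAt d i σ)
    (hτ : PreservesAt d i τ) : PreservesAt d i (σ * τ) :=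
  ⟨fun j x => (hσ.1 j (τ x)).trans (hτ.1 j x), fun x => (hσ.2 (τ ∘ x)).trans (hτ.2 x)⟩

theorem realize_term_perm {α : Type*} (σ : Equiv.Perm Pt) (t : (parityLang d).Term α)
    (v : α → Pt) : t.realize (σ ∘ v) = σ (t.realize v) := by
  cases t with
  | var => rfl
  | func f => exact f.elim

/-- Each formula is invariant under the permutations preserving a finite part of the structure. -/
theorem exists_forall_realize_perm_iff {α : Type*} {l : ℕ}
    (φ : (parityLang d).BoundedFormula α l) :
    ∃ N : ℕ, ∀ σ : Equiv.Perm Pt, (∀ i < N, PreservesAt d i σ) →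
      ∀ (v : α → Pt) (xs : Fin l → Pt), φ.Realize (σ ∘ v) (σ ∘ xs) ↔ φ.Realize v xs := by
  induction φ with
  | falsum => exact ⟨0, fun _ _ _ _ => Iff.rfl⟩
  | equal t₁ t₂ =>
    refine ⟨0, fun σ _ v xs => ?_⟩
    simp only [BoundedFormula.Realize, ← Sum.comp_elim, realize_term_perm, σ.apply_eq_iff_eq]
  | rel R ts =>
    cases R with
    | col i j =>
      refine ⟨i + 1, fun σ hσ v xs => ?_⟩
      simp only [BoundedFormula.Realize, ← Sum.comp_elim, realize_term_perm]
      exact (hσ i (Nat.lt_succ_self i)).1 j _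
    | par i =>
      refine ⟨i + 1, fun σ hσ v xs => ?_⟩
      simp only [BoundedFormula.Realize, ← Sum.comp_elim, realize_term_perm]
      exact (hσ i (Nat.lt_succ_self i)).2 _
  | imp φ ψ ih₁ ih₂ =>
    obtain ⟨N₁, h₁⟩ := ih₁
    obtain ⟨N₂, h₂⟩ := ih₂
    refine ⟨max N₁ N₂, fun σ hσ v xs => ?_⟩
    rw [BoundedFormula.realize_imp, BoundedFormula.realize_imp,
      h₁ σ (fun i hi => hσ i (lt_max_of_lt_left hi)),
      h₂ σ (fun i hi => hσ i (lt_max_of_lt_right hi))]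
  | all φ ih =>
    obtain ⟨N, h⟩ := ih
    refine ⟨N, fun σ hσ v xs => ?_⟩
    rw [BoundedFormula.realize_all, BoundedFormula.realize_all, ← σ.forall_congr_right]
    refine forall_congr' fun x => ?_
    rw [← h σ hσ v, Fin.comp_snoc]

theorem exists_forall_realize_formula_perm_iff {α : Type*} (φ : (parityLang d).Formula α) :
    ∃ N : ℕ, ∀ σ : Equiv.Perm Pt, (∀ i < N, PreservesAt d i σ) →
      ∀ v : α → Pt, φ.Realize (σ ∘ v) ↔ φ.Realize v := by
  obtain ⟨N, h⟩ := exists_forall_realize_perm_iff φ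
  refine ⟨N, fun σ hσ v => ?_⟩
  rw [← φ.boundedFormula_realize_eq_realize (σ ∘ v) (σ ∘ default), h σ hσ,
    φ.boundedFormula_realize_eq_realize]

/-- The permutation shifting the parity in the column `(i, j)` by `f i j`. -/
def flip (f : ℕ → ℕ → ZMod 2) : Equiv.Perm Pt where
  toFun x := (x.1, x.2.1, x.2.2 + f x.1 x.2.1)
  invFun x := (x.1, x.2.1, x.2.2 - f x.1 x.2.1)
  left_inv x := by simp
  right_inv x := by simp

theorem preservesAt_flip {f : ℕ → ℕ → ZMod 2} {i : ℕ} (h : ∑ j : Fin (d i), f i j = 0) :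
    PreservesAt d i (flip f) := by
  refine ⟨fun j x => Iff.rfl, fun x => and_congr_right fun hx => ?_⟩
  have : ∑ j, ((flip f ∘ x) j).2.2 = ∑ j, (x j).2.2 + ∑ j : Fin (d i), f i j := by
    rw [← Finset.sum_add_distrib]
    exact Finset.sum_congr rfl fun j _ =>
      congrArg ((x j).2.2 + ·) (congrArg₂ f (hx j).1 (hx j).2)
  rw [this, h, add_zero]

/-- By injectivity, no outside point can enter a column that is fixed pointwise. -/
theorem preservesAt_of_fixes {σ : Equiv.Perm Pt} {i : ℕ}
    (h : ∀ j : Fin (d i), ∀ x, InCol i j x → σ x = x) : PreservesAt d i σ := by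
  have hc : ∀ j : Fin (d i), ∀ x, InCol i j (σ x) ↔ InCol i j x := by
    refine fun j x => ⟨fun hx => ?_, fun hx => by rwa [h j x hx]⟩
    have := σ.injective (h j _ hx)
    rwa [this] at hx
  refine ⟨hc, fun x => ?_⟩
  unfold EvenTuple
  simp only [Function.comp_apply, hc]
  refine and_congr_right fun hx => ?_
  simp only [fun j => h j _ (hx j)]

/-! ### Conjugacy of tuples and quantifier elimination -/

/-- The column shifts carrying a tuple to another one with the same diagram at index `i`. -/
theorem exists_shift {k n i : ℕ} {v w : Fin k → Pt}
    (hc : ∀ (j : Fin n) a, InCol i j (v a) ↔ InCol i j (w a))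
    (hp : ∀ g : Fin n → Fin k, EvenTuple i (v ∘ g) ↔ EvenTuple i (w ∘ g))
    (he : ∀ a b, v a = v b ↔ w a = w b) :
    ∃ f : Fin n → ZMod 2, ∑ j, f j = 0 ∧
      ∀ (j : Fin n) a, InCol i j (v a) → (w a).2.2 = (v a).2.2 + f j := by
  have two : ∀ e e' f f' : ZMod 2, (e = e' ↔ f = f') → f' = e' + (f - e) := by decide
  have h1 : ∀ j : Fin n, ∃ s : ZMod 2, ∀ a, InCol i j (v a) → (w a).2.2 = (v a).2.2 + s := by
    intro j
    by_cases h : ∃ a, InCol i j (v a)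
    · obtain ⟨a, ha⟩ := h
      refine ⟨(w a).2.2 - (v a).2.2, fun b hb => two _ _ _ _ ?_⟩
      have ha' := (hc j a).1 ha
      have hb' := (hc j b).1 hb
      have := he a b
      simpa [Prod.ext_iff, ha.1, ha.2, hb.1, hb.2, ha'.1, ha'.2, hb'.1, hb'.2] using this
    · exact ⟨0, fun a ha => (h ⟨a, ha⟩).elim⟩
  choose s hs using h1
  -- If the tuple meets every column, parity of one transversal forces the shifts to sum to zero;
  -- otherwise an unmet column absorbs the total.
  by_cases hall : ∀ j : Fin n, ∃ a, InCol i j (v a)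
  · choose g hg using hall
    refine ⟨s, ?_, hs⟩
    have hpg := hp g
    have hv : ∀ j : Fin n, InCol i j ((v ∘ g) j) := hg
    have hw : ∀ j : Fin n, InCol i j ((w ∘ g) j) := fun j => (hc j (g j)).1 (hg j)
    have hsum : ∑ j, ((w ∘ g) j).2.2 = ∑ j, ((v ∘ g) j).2.2 + ∑ j, s j := by
      rw [← Finset.sum_add_distrib]
      exact Finset.sum_congr rfl fun j _ => hs j (g j) (hg j)
    simp only [EvenTuple, hv, hw, hsum, implies_true, true_and] at hpg
    have key : ∀ x y : ZMod 2, (x = 0 ↔ x + y = 0) → y = 0 := by decide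
    exact key _ _ hpg
  · push Not at hall
    obtain ⟨j₀, hj₀⟩ := hall
    refine ⟨Function.update s j₀ (s j₀ - ∑ j, s j), ?_, fun j a ha => ?_⟩
    · rw [Finset.sum_update_of_mem (Finset.mem_univ _),
        ← Finset.add_sum_erase _ s (Finset.mem_univ j₀), Finset.sdiff_singleton_eq_erase]
      ring
    · have : j ≠ j₀ := by
        rintro rfl
        exact hj₀ a ha
      rw [Function.update_of_ne this]
      exact hs j a ha

/-- Tuples with the same atomic diagram below `N` are conjugate under a permutation preserving the
structure below `N`. -/
theorem exists_perm_of_diagram {k N : ℕ} {v w : Fin k → Pt}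
    (hc : ∀ i < N, ∀ (j : Fin (d i)) a, InCol i j (v a) ↔ InCol i j (w a))
    (hp : ∀ i < N, ∀ g : Fin (d i) → Fin k, EvenTuple i (v ∘ g) ↔ EvenTuple i (w ∘ g))
    (he : ∀ a b, v a = v b ↔ w a = w b) :
    ∃ σ : Equiv.Perm Pt, (∀ i < N, PreservesAt d i σ) ∧ σ ∘ v = w := by
  have hf : ∀ i, ∃ f : Fin (d i) → ZMod 2, i < N → ∑ j, f j = 0 ∧
      ∀ (j : Fin (d i)) a, InCol i j (v a) → (w a).2.2 = (v a).2.2 + f j := by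
    intro i
    by_cases hi : i < N
    · obtain ⟨f, h⟩ := exists_shift (hc i hi) (hp i hi) he
      exact ⟨f, fun _ => h⟩
    · exact ⟨0, fun h => (hi h).elim⟩
  choose f hf using hf
  let F : ℕ → ℕ → ZMod 2 := fun i j => if h : j < d i then f i ⟨j, h⟩ else 0
  have hF : ∀ i (j : Fin (d i)), F i j = f i j := fun i j => by simp [F]
  -- The flip settles the named columns below `N`. All other points are indiscernible for the
  -- symbols below `N`, so `τ` may move them freely.
  obtain ⟨τ, hτ, hτv⟩ := exists_perm_extending (X := Pt) (v := flip F ∘ v) (w := w)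
    (fun x => x.1 < N ∧ x.2.1 < d x.1) (fun a b => by simpa using he a b)
    (by
      rintro a ⟨h₁, h₂⟩
      change (v a).1 < N at h₁
      change (v a).2.1 < d (v a).1 at h₂
      have hcol : InCol (v a).1 (⟨(v a).2.1, h₂⟩ : Fin (d (v a).1)) (v a) := ⟨rfl, rfl⟩
      have hw := (hc _ h₁ _ a).1 hcol
      have hs := (hf _ h₁).2 _ a hcol
      refine Prod.ext hw.1.symm (Prod.ext hw.2.symm ?_)
      rw [hs, ← hF]
      rfl)
    (by
      rintro a ⟨h₁, h₂⟩
      have hv := (hc _ h₁ ⟨_, h₂⟩ a).2 ⟨rfl, rfl⟩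
      change (v a).1 < N ∧ (v a).2.1 < d (v a).1
      have e1 : (v a).1 = (w a).1 := hv.1
      have e2 : (v a).2.1 = (w a).2.1 := hv.2
      rw [e1, e2]
      exact ⟨h₁, h₂⟩)
  refine ⟨τ * flip F, fun i hi => PreservesAt.mul (preservesAt_of_fixes ?_) (preservesAt_flip ?_),
    funext hτv⟩
  · rintro j x ⟨rfl, hj⟩
    exact hτ x ⟨hi, hj ▸ j.2⟩
  · simp only [hF]
    exact (hf i hi).1

variable (d) in
/-- The atomic formulas in `k` variables. -/
inductive IsAtomicFormula {k : ℕ} : (parityLang d).Formula (Fin k) → Prop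
  | col (i : ℕ) (j : Fin (d i)) (a : Fin k) : IsAtomicFormula (colFormula i j a)
  | par (i : ℕ) (g : Fin (d i) → Fin k) : IsAtomicFormula (parFormula i g)
  | eq (a b : Fin k) : IsAtomicFormula ((Term.var a).equal (Term.var b))

/-- Quantifier elimination. -/
theorem isBasedOn_atomic {k : ℕ} (φ : (parityLang d).Formula (Fin k)) :
    IsBasedOn (parityTheory d) {ψ | IsAtomicFormula d ψ} φ := by
  obtain ⟨N, hN⟩ := exists_forall_realize_formula_perm_iff φ
  let F : Set ((parityLang d).Formula (Fin k)) :=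
    (⋃ i : Fin N, Set.range fun p : Fin (d i) × Fin k => colFormula (i : ℕ) p.1 p.2) ∪
    (⋃ i : Fin N, Set.range fun g : Fin (d i) → Fin k => parFormula (i : ℕ) g) ∪
    Set.range fun p : Fin k × Fin k => (Term.var p.1).equal (Term.var p.2)
  have hF : F.Finite :=
    ((Set.finite_iUnion fun _ => Set.finite_range _).union
      (Set.finite_iUnion fun _ => Set.finite_range _)).union (Set.finite_range _)
  refine (IsBasedOn.of_finite (M := Pt) hF ?_).trans ?_
  · intro v w h hv
    obtain ⟨σ, hσ, rfl⟩ := exists_perm_of_diagram (d := d) (N := N) (v := v) (w := w)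
      (fun i hi j a => by
        rw [← realize_colFormula, ← realize_colFormula]
        exact h _ (.inl (.inl (Set.mem_iUnion.2 ⟨⟨i, hi⟩, (j, a), rfl⟩))))
      (fun i hi g => by
        rw [← realize_parFormula, ← realize_parFormula]
        exact h _ (.inl (.inr (Set.mem_iUnion.2 ⟨⟨i, hi⟩, g, rfl⟩))))
      (fun a b => by simpa using h _ (.inr ⟨(a, b), rfl⟩))
    exact (hN σ hσ v).2 hv
  · rintro δ ((h | h) | ⟨p, rfl⟩)
    · obtain ⟨i, p, rfl⟩ := Set.mem_iUnion.1 h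
      exact .of_mem (.col _ _ _)
    · obtain ⟨i, g, rfl⟩ := Set.mem_iUnion.1 h
      exact .of_mem (.par _ _)
    · exact .of_mem (.eq _ _)

/-! ### Parity is invisible to fewer variables -/

/-- The tuple of the even points of the columns `(i, 0), …, (i, n - 1)`. -/
def evenPts (i n : ℕ) : Fin n → Pt := fun l => (i, l, 0)

/-- The shift by `1` in the column `(i, j)` alone. -/
def colFlip (i j : ℕ) : Equiv.Perm Pt := flip fun a b => if a = i ∧ b = j then 1 else 0

theorem preservesAt_colFlip_of_ne {i i' j : ℕ} (h : i' ≠ i) : PreservesAt d i' (colFlip i j) :=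
  preservesAt_flip (by simp [h])

theorem preservesAt_colFlip_mul {i i' : ℕ} (j l : Fin (d i)) :
    PreservesAt d i' (colFlip i j * colFlip i l) := by
  rcases ne_or_eq i' i with h | rfl
  · exact (preservesAt_colFlip_of_ne h).mul (preservesAt_colFlip_of_ne h)
  · have : colFlip i' j * colFlip i' l = flip fun a b =>
        (if a = i' ∧ b = l then 1 else 0) + (if a = i' ∧ b = j then 1 else 0) := by
      ext x : 1
      simp [colFlip, flip, add_assoc]
    rw [this]
    refine preservesAt_flip ?_
    simp only [true_and, Finset.sum_add_distrib, Fin.val_inj, Finset.sum_ite_eq', Finset.mem_univ,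
      if_true]
    decide

theorem not_realize_parFormula_colFlip {i : ℕ} (j : Fin (d i)) :
    ¬ ((parFormula i id).Realize (evenPts i (d i)) ↔
      (parFormula i id).Realize (colFlip i j ∘ evenPts i (d i))) := by
  simp [realize_parFormula, EvenTuple, InCol, evenPts, colFlip, flip, Fin.val_inj]

/-- Some variable `l` is not free in `ψ`, so flipping column `l` as well goes unnoticed, and the
double flip preserves the structure. -/
theorem realize_iff_colFlip_of_card_lt {i : ℕ} (j : Fin (d i))
    (ψ : (parityLang d).Formula (Fin (d i))) (hψ : ψ.freeVarFinset.card < d i) :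
    ψ.Realize (evenPts i (d i)) ↔ ψ.Realize (colFlip i j ∘ evenPts i (d i)) := by
  obtain ⟨l, hl⟩ : ∃ l, l ∉ ψ.freeVarFinset := by
    by_contra! h
    rw [Finset.eq_univ_iff_forall.2 h] at hψ
    simp at hψ
  obtain ⟨N, hN⟩ := exists_forall_realize_formula_perm_iff ψ
  rw [← hN (colFlip i j * colFlip i l) (fun i' _ => preservesAt_colFlip_mul j l)]
  refine realize_iff_of_eqOn_freeVarFinset ψ fun a ha => ?_
  have : (a : ℕ) ≠ l := fun h => hl (Fin.ext h ▸ ha)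
  simp [colFlip, flip, evenPts, this]

/-- For `n < d i` the parity relation of index `i` is not a Boolean combination of formulas with at
most `n` free variables and of formulas that do not separate the even points from their shift. -/
theorem not_isBasedOn_parFormula {i n : ℕ} (hn : n < d i)
    {Δ : Set ((parityLang d).Formula (Fin (d i)))}
    (hΔ : ∀ δ ∈ Δ, δ.Realize (evenPts i (d i)) ↔
      δ.Realize (colFlip i 0 ∘ evenPts i (d i))) :
    ¬ IsBasedOn (parityTheory d) (formulasOfArity (parityLang d) n (d i) ∪ Δ)
      (parFormula i id) := by
  intro h
  have h0 : 0 < d i := by omega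
  refine not_realize_parFormula_colFlip ⟨0, h0⟩ (h.realize_iff ?_)
  rintro δ (hδ | hδ)
  · exact realize_iff_colFlip_of_card_lt ⟨0, h0⟩ δ (lt_of_le_of_lt hδ hn)
  · exact hΔ δ hδ

end Parity

/-! ### Computing arity and almost arity -/

section Arity

variable {d : ℕ → ℕ}

theorem isNAry_parityTheory {n : ℕ} (hn : 1 ≤ n) (hd : ∀ i, d i ≤ n) :
    IsNAry (parityTheory d) n := by
  unfold IsNAry
  split_ifs with h
  · subst h
    refine fun k φ => (isBasedOn_atomic φ).trans ?_
    rintro _ (⟨i, j, a⟩ | ⟨i, g⟩ | ⟨a, b⟩)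
    · exact .of_mem (.inl (card_freeVarFinset_colFormula_le i j a))
    · exact .of_mem (.inl ((card_freeVarFinset_parFormula_le i g).trans (hd i)))
    · exact .of_mem (.inr ⟨a, b, rfl⟩)
  · refine fun k φ => (isBasedOn_atomic φ).trans ?_
    rintro _ (⟨i, j, a⟩ | ⟨i, g⟩ | ⟨a, b⟩)
    · exact .of_mem ((card_freeVarFinset_colFormula_le i j a).trans hn)
    · exact .of_mem ((card_freeVarFinset_parFormula_le i g).trans (hd i))
    · exact .of_mem ((card_freeVarFinset_equal_le a b).trans (by omega))

theorem not_isNAry_parityTheory {i n : ℕ} (hn : n < d i) : ¬ IsNAry (parityTheory d) n := by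
  unfold IsNAry
  split_ifs with h
  · subst h
    intro hu
    refine not_isBasedOn_parFormula hn ?_ (hu _ _)
    rintro _ ⟨a, b, rfl⟩
    simp
  · intro hu
    refine not_isBasedOn_parFormula hn (Δ := ∅) (by simp) ?_
    rw [Set.union_empty]
    exact hu _ _

theorem isAlmostNAry_parityTheory {m : ℕ} (hm : 1 ≤ m) (h0 : 1 ≤ d 0)
    (hd : ∀ i, i ≠ 0 → d i ≤ m) : IsAlmostNAry (parityTheory d) m := by
  -- Equality is included because it need not be a 1-formula when `m = 1`; it uses the last two of
  -- the common variables.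
  refine ⟨d 0 + 2, {parFormula 0 (Fin.castAdd 2),
    (Term.var (Fin.natAdd (d 0) 0)).equal (Term.var (Fin.natAdd (d 0) 1))}, by simp, ?_⟩
  refine fun k φ => (isBasedOn_atomic φ).trans ?_
  rintro _ (⟨i, j, a⟩ | ⟨i, g⟩ | ⟨a, b⟩)
  · exact .of_mem (.inl (.of_mem ((card_freeVarFinset_colFormula_le i j a).trans hm)))
  · by_cases hi : i = 0
    · subst hi
      -- The two idle variables need some value; `h0` supplies one.
      refine .of_forall_realize_iff (.inr ⟨_, .inl rfl, Fin.append g fun _ => g ⟨0, h0⟩, rfl⟩)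
        fun v => ?_
      rw [Formula.realize_relabel, realize_parFormula, realize_parFormula]
      have : Fin.append g (fun _ : Fin 2 => g ⟨0, h0⟩) ∘ Fin.castAdd 2 = g := by
        ext l
        simp
      rw [Function.comp_assoc, this]
    · exact .of_mem (.inl (.of_mem ((card_freeVarFinset_parFormula_le i g).trans (hd i hi))))
  · refine .of_forall_realize_iff
      (.inr ⟨_, .inr rfl, Fin.append (fun _ : Fin (d 0) => a) ![a, b], rfl⟩) fun v => ?_
    simp only [Formula.realize_relabel, Formula.realize_equal, Term.realize_var,
      Function.comp_apply, Fin.append_right]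
    rfl

/-- Beyond a common bound `B` for the indices seen by `Φ`, a single column flip is invisible to all
substitution instances of `Φ`. -/
theorem not_isAlmostNAry_parityTheory {n : ℕ} (hn : ∀ N, ∃ i ≥ N, n < d i) :
    ¬ IsAlmostNAry (parityTheory d) n := by
  rintro ⟨r, Φ, hΦ, h⟩
  choose N hN using fun φ : (parityLang d).Formula (Fin r) =>
    exists_forall_realize_formula_perm_iff φ
  obtain ⟨B, hB⟩ := (hΦ.image N).bddAbove
  obtain ⟨i, hi, hni⟩ := hn B
  have hbased := h (d i) (parFormula i id)
  refine not_isBasedOn_parFormula hni (Δ := substitutions Φ (d i)) ?_ (hbased.trans ?_)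
  · rintro _ ⟨φ, hφ, f, rfl⟩
    rw [Formula.realize_relabel, Formula.realize_relabel, Function.comp_assoc]
    refine (hN φ _ (fun i' hi' => preservesAt_colFlip_of_ne ?_) _).symm
    have := hB (Set.mem_image_of_mem N hφ)
    omega
  · rintro δ (hδ | hδ)
    · exact IsBasedOn.trans hδ fun ε hε => .of_mem (.inl hε)
    · exact .of_mem (.inr hδ)

end Arity

/-- The parity relation of index `0` has arity `n`, all the others have arity `m`. -/
def arities (m n : ℕ) : ℕ → ℕ
  | 0 => n
  | _ + 1 => m

theorem ar_parityTheory {m n : ℕ} (hm : 1 ≤ m) (hmn : m ≤ n) :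
    ar (parityTheory (arities m n)) = n := by
  refine le_antisymm (sInf_le ⟨n, isNAry_parityTheory (hm.trans hmn) ?_, rfl⟩) (le_sInf ?_)
  · rintro (_ | i)
    exacts [le_rfl, hmn]
  · rintro _ ⟨j, hj, rfl⟩
    by_contra! hlt
    exact not_isNAry_parityTheory (i := 0) (by exact_mod_cast hlt) hj

theorem aar_parityTheory {m n : ℕ} (hm : 1 ≤ m) (hmn : m ≤ n) :
    aar (parityTheory (arities m n)) = m := by
  refine le_antisymm (sInf_le ⟨m, isAlmostNAry_parityTheory hm (hm.trans hmn) ?_, rfl⟩)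
    (le_sInf ?_)
  · rintro (_ | i) hi
    exacts [(hi rfl).elim, le_rfl]
  · rintro _ ⟨j, hj, rfl⟩
    by_contra! hlt
    exact not_isAlmostNAry_parityTheory
      (fun N => ⟨N + 1, Nat.le_succ N, by exact_mod_cast hlt⟩) hj

end ArityOfTheories

theorem mainTheorem3 (m n : ℕ) (hm : 1 ≤ m) (hmn : m ≤ n) :
    ∃ (L : FirstOrder.Language.{0, 0}) (T : L.Theory), T.IsComplete ∧
      ArityOfTheories.aar T = m ∧ ArityOfTheories.ar T = n :=
  ⟨ArityOfTheories.parityLang (ArityOfTheories.arities m n),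
    ArityOfTheories.parityTheory (ArityOfTheories.arities m n),
    FirstOrder.Language.completeTheory.isComplete _ _,
    ArityOfTheories.aar_parityTheory hm hmn, ArityOfTheories.ar_parityTheory hm hmn⟩
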